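/- Let $m,n$ be positive integers with $m\ge 3$, $n\mid m$ and $(m,n)\neq(3,1)$. Let $$\Gamma(m,n)=\left\{\begin{pmatrix}a&b\\c&d\end{pmatrix}\in \mathrm{SL}_2(\mathbb Z)\ :\ a\equiv 1,\ b\equiv 0 \pmod m,\ \ c\equiv 0,\ d\equiv 1 \pmod n\right\},$$ and let $\overline{\Gamma}(m,n)$ denote the image of $\Gamma(m,n)$ under the natural projection $\mathrm{SL}_2(\mathbb Z)\to \mathrm{PSL}_2(\mathbb Z)$. Then $\Gamma(m,n)$ and $\overline{\Gamma}(m,n)$ are both free groups of rank $$1+\frac{nm^2}{12}\prod_{\substack{p\mid m\\ p\text{ prime}}}\left(1-\frac1{p^2}\right).$$ -/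

import Mathlib

open scoped MatrixGroups

/-- The congruence subgroup `Γ(m,n)` of `SL₂(ℤ)`: the matrices with first row congruent to `(1, 0)`
modulo `m` and second row congruent to `(0, 1)` modulo `n`. -/
def CongruenceSubgroup.GammaPair (m n : ℕ) : Subgroup SL(2, ℤ) where
  carrier := {A | A 0 0 ≡ 1 [ZMOD m] ∧ A 0 1 ≡ 0 [ZMOD m] ∧ A 1 0 ≡ 0 [ZMOD n] ∧ A 1 1 ≡ 1 [ZMOD n]}
  one_mem' := by simp [Int.ModEq.refl]
  mul_mem' := by
    rintro A B ⟨ha, hb, hc, hd⟩ ⟨ha', hb', hc', hd'⟩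
    simp only [Set.mem_ofPred_eq, Matrix.SpecialLinearGroup.coe_mul, Matrix.mul_apply,
      Fin.sum_univ_two]
    refine ⟨?_, ?_, ?_, ?_⟩
    · simpa using (ha.mul ha').add (hb.mul_right (B 1 0))
    · simpa using (hb'.mul_left (A 0 0)).add (hb.mul_right (B 1 1))
    · simpa using (hc.mul_right (B 0 0)).add (hc'.mul_left (A 1 1))
    · simpa using (hc.mul_right (B 0 1)).add (hd.mul hd')
  inv_mem' := by
    rintro A ⟨ha, hb, hc, hd⟩
    have hdet : A 0 0 * A 1 1 - A 0 1 * A 1 0 = 1 := by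
      have h := A.det_coe
      rwa [Matrix.det_fin_two] at h
    simp only [Set.mem_ofPred_eq, Matrix.SpecialLinearGroup.SL2_inv_expl]
    refine ⟨?_, ?_, ?_, ?_⟩
    · have h := (ha.mul_right (A 1 1)).sub (hb.mul_right (A 1 0))
      rw [hdet] at h
      simpa using h.symm
    · simpa using hb.neg
    · simpa using hc.neg
    · have h := (hd.mul_left (A 0 0)).sub (hc.mul_left (A 0 1))
      rw [hdet] at h
      simpa using h.symm

/-- The image of `Γ(m,n)` in `PSL₂(ℤ)` under the natural projection. -/
def CongruenceSubgroup.ProjGammaPair (m n : ℕ) : Subgroup PSL(2, ℤ) :=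
  (CongruenceSubgroup.GammaPair m n).map
    (QuotientGroup.mk' (Subgroup.center SL(2, ℤ)))

/-- A group is free of rank `r` if it has a free basis with `r` elements. -/
def IsFreeGroupOfRank (G : Type*) [Group G] (r : ℕ) : Prop :=
  Nonempty (FreeGroupBasis (Fin r) G)

/-! `PSL(2, ℤ)` is the free product of cyclic groups of orders 2 and 3 generated by the classes of
`S` and `U` (`isModularPresentation`, by ping-pong). Let `H` be the image of `Γ(m,n)`. Modulo `m`
its lifts in `Γ(m,n)` have trace 2, while conjugates of `±S`, `±U` have trace 0 or `±1`; so `S` and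
`U` act without fixed points on the `N` cosets of `H`. The one collision, `-1 ≡ 2 (mod 3)`, is
settled modulo 9 for `n = 3`; `Γ(3,1)` does contain the order-three matrix with rows `(1, -3)`, `(1,
-2)`.

A functor from the action groupoid of these cosets to a group is a pair of labellings satisfying the
relations of `S` and `U`. As orbits have full size, these relations are solved by free labels on
half, respectively two thirds, of the cosets. The groupoid is thus free on `N/2 + 2N/3` arrows, and
its vertex group `H` is free of rank `1 + 7N/6 - N = 1 + N/6`.

Finally `Γ(m,n)` has index `n * J₂(m)` in `SL(2, ℤ)`, with `J₂(m)` the number of unimodular pairs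
modulo `m`. As `-1 ∉ Γ(m,n)`, the projection to `H` is injective and `2N = n * J₂(m)`. -/

/-- The elements `s`, `u` present `G` as the free product of cyclic groups of orders `2` and `3`. -/
structure IsModularPresentation {G : Type*} [Group G] (s u : G) : Prop where
  sq_eq_one : s ^ 2 = 1
  cube_eq_one : u ^ 3 = 1
  hom_ext : ∀ {L : Type} [Group L] (f g : G →* L), f s = g s → f u = g u → f = g
  exists_lift : ∀ {L : Type} [Group L] (a b : L), a ^ 2 = 1 → b ^ 3 = 1 →
    ∃ f : G →* L, f s = a ∧ f u = b

/-- The homomorphism from a cyclic group of order `n` determined by an element with `g ^ n = 1`. -/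
def zmodPowHom {L : Type*} [Group L] (n : ℕ) (g : L) (hg : g ^ n = 1) :
    Multiplicative (ZMod n) →* L :=
  AddMonoidHom.toMultiplicativeLeft
    (ZMod.lift n ⟨zmultiplesHom (Additive L) (Additive.ofMul g), by
      simpa [← ofMul_zpow, ← ofMul_pow] using hg⟩)

lemma zmodPowHom_intCast {L : Type*} [Group L] (n : ℕ) (g : L) (hg : g ^ n = 1) (k : ℤ) :
    zmodPowHom n g hg (Multiplicative.ofAdd (k : ZMod n)) = g ^ k := by
  simp [zmodPowHom]

lemma zmodPowHom_one {L : Type*} [Group L] (n : ℕ) (g : L) (hg : g ^ n = 1) :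
    zmodPowHom n g hg (Multiplicative.ofAdd 1) = g := by
  simpa using zmodPowHom_intCast n g hg 1

/-! ### `PSL(2, ℤ)` as a free product, by ping-pong -/

namespace ModularGroup

/-- The matrix `T * S`, which acts on the projective line as `x ↦ 1 - 1 / x`. -/
def U : SL(2, ℤ) := T * S

/-- The class of `S` in `PSL(2, ℤ)`. -/
def projS : PSL(2, ℤ) := QuotientGroup.mk' (Subgroup.center SL(2, ℤ)) S

/-- The class of `U` in `PSL(2, ℤ)`. -/
def projU : PSL(2, ℤ) := QuotientGroup.mk' (Subgroup.center SL(2, ℤ)) U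

lemma mem_center_iff_eq_one_or_neg_one (A : SL(2, ℤ)) :
    A ∈ Subgroup.center SL(2, ℤ) ↔ A = 1 ∨ A = -1 := by
  rw [Matrix.SpecialLinearGroup.mem_center_iff]
  constructor
  · rintro ⟨r, hr, hA⟩
    rw [Fintype.card_fin, sq_eq_one_iff] at hr
    rcases hr with rfl | rfl
    · left; ext1; rw [← hA]; simp
    · right
      ext i j
      have := congrFun (congrFun hA i) j
      rw [← this]
      fin_cases i <;> fin_cases j <;> simp
  · rintro (rfl | rfl)
    · exact ⟨1, by simp, by simp⟩
    · refine ⟨-1, by simp, ?_⟩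
      ext i j
      fin_cases i <;> fin_cases j <;> simp

/-- The product of the entries of the first column, a function on `PSL(2, ℤ)`. -/
def colProd : PSL(2, ℤ) → ℤ :=
  Quotient.lift (fun A : SL(2, ℤ) => A 0 0 * A 1 0) (by
    intro A B h
    have h' : A⁻¹ * B ∈ Subgroup.center SL(2, ℤ) := QuotientGroup.leftRel_apply.mp h
    rw [mem_center_iff_eq_one_or_neg_one] at h'
    rcases h' with h' | h'
    · rw [inv_mul_eq_one.mp h']
    · have : B = -A := by rw [inv_mul_eq_iff_eq_mul.mp h']; simp
      subst this
      simp)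

lemma colProd_mk (A : SL(2, ℤ)) :
    colProd (QuotientGroup.mk' (Subgroup.center SL(2, ℤ)) A) = A 0 0 * A 1 0 := rfl

lemma coe_U : (U : Matrix (Fin 2) (Fin 2) ℤ) = !![1, -1; 1, 0] := by
  simp [U, coe_S, coe_T]

lemma projS_sq : projS ^ 2 = 1 := by
  rw [projS, ← map_pow]
  refine (QuotientGroup.eq_one_iff _).mpr ?_
  rw [mem_center_iff_eq_one_or_neg_one]
  right
  ext i j
  fin_cases i <;> fin_cases j <;> simp [pow_two, coe_S]

lemma projU_cube : projU ^ 3 = 1 := by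
  rw [projU, ← map_pow]
  refine (QuotientGroup.eq_one_iff _).mpr ?_
  rw [mem_center_iff_eq_one_or_neg_one]
  right
  ext i j
  fin_cases i <;> fin_cases j <;> simp [pow_succ, coe_U, Matrix.mul_apply]

/-- For a first column `(a, c)`, `colProd` has the sign of `a / c`, the image of `∞`. The ping-pong
maps are `x ↦ -1/x` for `S`, `x ↦ 1 - 1/x` for `U` and `x ↦ 1/(1 - x)` for `U ^ 2`: the first makes
positive `x` negative, the others make negative `x` positive. -/
lemma colProd_projS_mul (g : PSL(2, ℤ)) (h : 0 < colProd g) : colProd (projS * g) < 0 := by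
  obtain ⟨A, rfl⟩ := QuotientGroup.mk'_surjective _ g
  rw [projS, ← map_mul, colProd_mk]
  rw [colProd_mk] at h
  simp [coe_S, Matrix.mul_apply, Fin.sum_univ_two]
  nlinarith

lemma colProd_projU_mul (g : PSL(2, ℤ)) (h : colProd g < 0) : 0 < colProd (projU * g) := by
  obtain ⟨A, rfl⟩ := QuotientGroup.mk'_surjective _ g
  rw [projU, ← map_mul, colProd_mk]
  rw [colProd_mk] at h
  simp [coe_U, Matrix.mul_apply, Fin.sum_univ_two]
  nlinarith [sq_nonneg (A 0 0)]

lemma colProd_projU_sq_mul (g : PSL(2, ℤ)) (h : colProd g < 0) :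
    0 < colProd (projU ^ 2 * g) := by
  obtain ⟨A, rfl⟩ := QuotientGroup.mk'_surjective _ g
  rw [projU, pow_two, mul_assoc, ← map_mul, ← map_mul, colProd_mk]
  rw [colProd_mk] at h
  simp [coe_U, Matrix.mul_apply, Fin.sum_univ_two, Matrix.vecMul, dotProduct]
  nlinarith [sq_nonneg (A 1 0)]

/-- The two free factors of `PSL(2, ℤ)`, of orders `2` and `3`. -/
abbrev Factor (i : Bool) : Type := Multiplicative (ZMod (cond i 3 2))

/-- The embeddings of the two factors. -/
def factorHom {L : Type*} [Group L] (a b : L) (ha : a ^ 2 = 1) (hb : b ^ 3 = 1) :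
    ∀ i : Bool, Factor i →* L
  | false => zmodPowHom 2 a ha
  | true => zmodPowHom 3 b hb

lemma factorHom_false_one {L : Type*} [Group L] (a b : L) (ha : a ^ 2 = 1) (hb : b ^ 3 = 1) :
    factorHom a b ha hb false (Multiplicative.ofAdd (1 : ZMod 2)) = a :=
  zmodPowHom_one 2 a ha

lemma factorHom_true_one {L : Type*} [Group L] (a b : L) (ha : a ^ 2 = 1) (hb : b ^ 3 = 1) :
    factorHom a b ha hb true (Multiplicative.ofAdd (1 : ZMod 3)) = b :=
  zmodPowHom_one 3 b hb

open Pointwise in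
lemma lift_factorHom_injective : Function.Injective
    (Monoid.CoprodI.lift (factorHom projS projU projS_sq projU_cube)) := by
  -- With only two factors, ping-pong needs one of them to have at least three elements.
  refine Monoid.CoprodI.lift_injective_of_ping_pong _ (Or.inr ⟨true, ?_⟩)
    (fun i => {g : PSL(2, ℤ) | if i then 0 < colProd g else colProd g < 0}) ?_ ?_ ?_
  · change 3 ≤ Cardinal.mk (ZMod 3)
    rw [Cardinal.mk_fintype, ZMod.card]
    norm_num
  · have h1 : 0 < colProd (QuotientGroup.mk' _ (T * S * T)) := by
      rw [colProd_mk]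
      simp [coe_T, coe_S]
    rintro (_ | _)
    · exact ⟨_, colProd_projS_mul _ (by exact h1)⟩
    · exact ⟨_, h1⟩
  · rintro (_ | _) (_ | _) hij <;> simp only [ne_eq, not_true_eq_false] at hij
    all_goals
      refine Set.disjoint_left.mpr fun g h1 h2 => ?_
      simp at h1 h2
      omega
  · rintro (_ | _) (_ | _) hij h hh <;> simp only [ne_eq, not_true_eq_false] at hij
    · rintro _ ⟨g, hg, rfl⟩
      have key : ∀ x : Multiplicative (ZMod 2), x ≠ 1 → x = Multiplicative.ofAdd 1 := by decide
      obtain rfl := key h hh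
      rw [factorHom_false_one]
      simpa using colProd_projS_mul g (by simpa using hg)
    · rintro _ ⟨g, hg, rfl⟩
      have key : ∀ x : Multiplicative (ZMod 3), x ≠ 1 →
          x = Multiplicative.ofAdd 1 ∨ x = Multiplicative.ofAdd 1 ^ 2 := by decide
      obtain rfl | rfl := key h hh
      · rw [factorHom_true_one]
        simpa using colProd_projU_mul g (by simpa using hg)
      · rw [map_pow, factorHom_true_one]
        simpa using colProd_projU_sq_mul g (by simpa using hg)

lemma closure_projS_projU : Subgroup.closure {projS, projU} = ⊤ := by
  rw [eq_top_iff]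
  have h : (Subgroup.closure {S, T}).map (QuotientGroup.mk' (Subgroup.center SL(2, ℤ))) = ⊤ := by
    rw [SpecialLinearGroup.SL2Z_generators, ← MonoidHom.range_eq_map]
    exact MonoidHom.range_eq_top.mpr (QuotientGroup.mk'_surjective _)
  rw [← h, MonoidHom.map_closure, Subgroup.closure_le]
  have hS : projS ∈ Subgroup.closure {projS, projU} := Subgroup.subset_closure (by simp)
  have hU : projU ∈ Subgroup.closure {projS, projU} := Subgroup.subset_closure (by simp)
  rintro _ ⟨A, rfl | rfl, rfl⟩
  · exact hS
  · have : QuotientGroup.mk' (Subgroup.center SL(2, ℤ)) T = projU * projS⁻¹ := by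
      rw [projU, projS, U, map_mul, mul_inv_cancel_right]
    rw [this]
    exact mul_mem hU (inv_mem hS)

lemma lift_factorHom_surjective : Function.Surjective
    (Monoid.CoprodI.lift (factorHom projS projU projS_sq projU_cube)) := by
  rw [← MonoidHom.range_eq_top, eq_top_iff, ← closure_projS_projU, Subgroup.closure_le]
  rintro _ (rfl | rfl)
  · exact ⟨Monoid.CoprodI.of (i := false) (Multiplicative.ofAdd (1 : ZMod 2)), by
      rw [Monoid.CoprodI.lift_of, factorHom_false_one]⟩
  · exact ⟨Monoid.CoprodI.of (i := true) (Multiplicative.ofAdd (1 : ZMod 3)), by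
      rw [Monoid.CoprodI.lift_of, factorHom_true_one]⟩

/-- `PSL(2, ℤ)` is the free product of the cyclic groups generated by `projS` and `projU`. -/
theorem isModularPresentation : IsModularPresentation projS projU where
  sq_eq_one := projS_sq
  cube_eq_one := projU_cube
  hom_ext f g hs hu := by
    refine MonoidHom.eq_of_eqOn_dense closure_projS_projU ?_
    rintro _ (rfl | rfl) <;> assumption
  exists_lift a b ha hb := by
    let e := MulEquiv.ofBijective _ ⟨lift_factorHom_injective, lift_factorHom_surjective⟩
    refine ⟨(Monoid.CoprodI.lift (factorHom a b ha hb)).comp e.symm.toMonoidHom, ?_, ?_⟩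
    · have : e.symm projS = Monoid.CoprodI.of (i := false)
          (Multiplicative.ofAdd (1 : ZMod 2)) := by
        rw [MulEquiv.symm_apply_eq]
        exact ((Monoid.CoprodI.lift_of _ _).trans (factorHom_false_one _ _ projS_sq projU_cube)).symm
      simp only [MonoidHom.comp_apply, MulEquiv.toMonoidHom_eq_coe, MonoidHom.coe_coe, this,
        Monoid.CoprodI.lift_of]
      exact factorHom_false_one ..
    · have : e.symm projU = Monoid.CoprodI.of (i := true)
          (Multiplicative.ofAdd (1 : ZMod 3)) := by
        rw [MulEquiv.symm_apply_eq]
        exact ((Monoid.CoprodI.lift_of _ _).trans (factorHom_true_one _ _ projS_sq projU_cube)).symm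
      simp only [MonoidHom.comp_apply, MulEquiv.toMonoidHom_eq_coe, MonoidHom.coe_coe, this,
        Monoid.CoprodI.lift_of]
      exact factorHom_true_one ..

end ModularGroup

/-! ### Counting unimodular pairs modulo `m` -/

section UnimodularPairs

/-- The pairs of elements generating the unit ideal. -/
abbrev UnimodularPairs (R : Type*) [CommRing R] : Type _ := {v : R × R // IsCoprime v.1 v.2}

lemma isCoprime_map_ringEquiv {R S : Type*} [CommRing R] [CommRing S] (e : R ≃+* S) (a b : R) :
    IsCoprime (e a) (e b) ↔ IsCoprime a b :=
  ⟨fun h => by simpa using h.map e.symm.toRingHom, fun h => h.map e.toRingHom⟩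

lemma isCoprime_prod_iff {R S : Type*} [CommRing R] [CommRing S] (a b : R × S) :
    IsCoprime a b ↔ IsCoprime a.1 b.1 ∧ IsCoprime a.2 b.2 := by
  constructor
  · exact fun h => ⟨h.map (RingHom.fst R S), h.map (RingHom.snd R S)⟩
  · rintro ⟨⟨x, y, h⟩, ⟨z, w, h'⟩⟩
    exact ⟨(x, z), (y, w), Prod.ext h h'⟩

lemma card_unimodularPairs_congr {R S : Type*} [CommRing R] [CommRing S] (e : R ≃+* S) :
    Nat.card (UnimodularPairs R) = Nat.card (UnimodularPairs S) :=
  Nat.card_congr (Equiv.subtypeEquiv (Equiv.prodCongr e.toEquiv e.toEquiv)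
    fun v => (isCoprime_map_ringEquiv e v.1 v.2).symm)

lemma card_unimodularPairs_prod (R S : Type*) [CommRing R] [CommRing S] :
    Nat.card (UnimodularPairs (R × S)) =
      Nat.card (UnimodularPairs R) * Nat.card (UnimodularPairs S) := by
  rw [← Nat.card_prod]
  refine Nat.card_congr ((Equiv.subtypeEquiv (Equiv.prodProdProdComm R S R S)
    (q := fun w => IsCoprime w.1.1 w.1.2 ∧ IsCoprime w.2.1 w.2.2)
    fun v => isCoprime_prod_iff v.1 v.2).trans (Equiv.subtypeProdEquivProd
      (p := fun v : R × R => IsCoprime v.1 v.2)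
      (q := fun v : S × S => IsCoprime v.1 v.2)))

/-- `ZMod (p ^ k)` is local: all nonunits vanish modulo `p`, so two of them cannot generate `1`. -/
lemma ZMod.isCoprime_prime_pow_iff {p k : ℕ} (hp : p.Prime) (hk : 0 < k) (a b : ZMod (p ^ k)) :
    IsCoprime a b ↔ IsUnit a ∨ IsUnit b := by
  have := Fact.mk hp
  have hz : ∀ x : ZMod (p ^ k), ¬ IsUnit x →
      ZMod.castHom (dvd_pow_self p hk.ne') (ZMod p) x = 0 := by
    intro x hx
    have : NeZero (p ^ k) := ⟨pow_ne_zero _ hp.ne_zero⟩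
    rw [← ZMod.natCast_zmod_val x, ZMod.isUnit_iff_coprime, Nat.coprime_pow_right_iff hk,
      Nat.coprime_comm, hp.coprime_iff_not_dvd, not_not] at hx
    rw [← ZMod.natCast_zmod_val x, map_natCast, ZMod.natCast_eq_zero_iff]
    exact hx
  constructor
  · intro h
    by_contra hab
    rw [not_or] at hab
    have h' := h.map (ZMod.castHom (dvd_pow_self p hk.ne') (ZMod p))
    rw [hz a hab.1, hz b hab.2] at h'
    exact not_isCoprime_zero_zero h'
  · rintro (h | h)
    · obtain ⟨c, hc⟩ := h.exists_left_inv
      exact ⟨c, 0, by rw [hc]; ring⟩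
    · obtain ⟨c, hc⟩ := h.exists_left_inv
      exact ⟨0, c, by rw [hc]; ring⟩

lemma ZMod.card_nonunits_prime_pow {p k : ℕ} (hp : p.Prime) (hk : 0 < k) :
    Nat.card {x : ZMod (p ^ k) // ¬ IsUnit x} = p ^ (k - 1) := by
  have : NeZero (p ^ k) := ⟨pow_ne_zero _ hp.ne_zero⟩
  classical
  have h := Fintype.card_subtype_compl (fun x : ZMod (p ^ k) => IsUnit x)
  have h2 : Fintype.card {x : ZMod (p ^ k) // IsUnit x} = p ^ (k - 1) * (p - 1) := by
    rw [← Nat.totient_prime_pow hp hk, ← ZMod.card_units_eq_totient]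
    exact Fintype.card_congr ((Equiv.ofInjective _ Units.val_injective).trans
      (Equiv.subtypeEquivRight fun _ => Iff.rfl)).symm
  rw [Nat.card_eq_fintype_card, h, h2, ZMod.card]
  obtain ⟨j, rfl⟩ : ∃ j, k = j + 1 := ⟨k - 1, by omega⟩
  obtain ⟨q, rfl⟩ : ∃ q, p = q + 1 := ⟨p - 1, by have := hp.pos; omega⟩
  simp only [Nat.add_sub_cancel, pow_succ]
  rw [mul_add, mul_one, Nat.add_sub_cancel_left]

lemma card_unimodularPairs_prime_pow {p k : ℕ} (hp : p.Prime) (hk : 0 < k) :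
    Nat.card (UnimodularPairs (ZMod (p ^ k))) + (p ^ (k - 1)) ^ 2 = (p ^ k) ^ 2 := by
  have : NeZero (p ^ k) := ⟨pow_ne_zero _ hp.ne_zero⟩
  classical
  have hc : Nat.card {v : ZMod (p ^ k) × ZMod (p ^ k) // ¬ IsCoprime v.1 v.2} =
      (p ^ (k - 1)) ^ 2 := by
    rw [← ZMod.card_nonunits_prime_pow hp hk, pow_two, ← Nat.card_prod]
    refine Nat.card_congr ((Equiv.subtypeEquivRight fun v => ?_).trans
      (Equiv.subtypeProdEquivProd (p := fun x => ¬ IsUnit x) (q := fun x => ¬ IsUnit x)))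
    rw [ZMod.isCoprime_prime_pow_iff hp hk, not_or]
  rw [← hc, UnimodularPairs, ← Nat.card_sum,
    Nat.card_congr (Equiv.sumCompl fun v : ZMod (p ^ k) × ZMod (p ^ k) => IsCoprime v.1 v.2),
    Nat.card_prod, Nat.card_zmod, pow_two]

/-- The Jordan totient `J₂` counts unimodular pairs. -/
theorem card_unimodularPairs_zmod {m : ℕ} (hm : m ≠ 0) :
    (Nat.card (UnimodularPairs (ZMod m)) : ℚ) =
      m ^ 2 * ∏ p ∈ m.primeFactors, (1 - 1 / (p : ℚ) ^ 2) := by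
  induction m using Nat.recOnPosPrimePosCoprime with
  | zero => exact absurd rfl hm
  | one =>
    have : Nat.card (UnimodularPairs (ZMod 1)) = 1 := by
      have : Unique (UnimodularPairs (ZMod 1)) :=
        { default := ⟨0, 0, 0, Subsingleton.elim _ _⟩
          uniq := fun a => Subtype.ext (Subsingleton.elim (α := ZMod 1 × ZMod 1) _ _) }
      exact Nat.card_unique
    simp [this]
  | prime_pow p k hp hk =>
    rw [Nat.primeFactors_prime_pow hk.ne' hp, Finset.prod_singleton]
    have h := congrArg (Nat.cast (R := ℚ)) (card_unimodularPairs_prime_pow hp hk)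
    obtain ⟨j, rfl⟩ : ∃ j, k = j + 1 := ⟨k - 1, by omega⟩
    have hp0 : (p : ℚ) ≠ 0 := by exact_mod_cast hp.ne_zero
    push_cast at h ⊢
    rw [eq_sub_of_add_eq h]
    field_simp
    ring
  | coprime a b ha hb hab iha ihb =>
    rw [card_unimodularPairs_congr (ZMod.chineseRemainder hab), card_unimodularPairs_prod,
      Nat.cast_mul, iha (by omega), ihb (by omega), hab.primeFactors_mul,
      Finset.prod_union hab.disjoint_primeFactors]
    push_cast
    ring

end UnimodularPairs

/-- Fix a lift `y` of `b`. Modulo `gcd(m, y)` the element `a` is a unit, hence lifts to a unit `w`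
modulo `y`. By Bézout some `x` is congruent to `w` modulo `y` and to `a` modulo `m`. -/
lemma ZMod.exists_isCoprime_intCast_eq {m : ℕ} (hm : m ≠ 0) (a b : ZMod m) (hab : IsCoprime a b) :
    ∃ x y : ℤ, IsCoprime x y ∧ (x : ZMod m) = a ∧ (y : ZMod m) = b := by
  have : NeZero m := ⟨hm⟩
  -- Adding `m` keeps `y` nonzero when `b = 0`.
  let y : ℕ := b.val + m
  have : NeZero y := ⟨by omega⟩
  have hy : (y : ZMod m) = b := by simp [y]
  have hdm : Nat.gcd m y ∣ m := Nat.gcd_dvd_left _ _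
  have hdy : Nat.gcd m y ∣ y := Nat.gcd_dvd_right _ _
  have hu : IsUnit (ZMod.castHom hdm (ZMod (Nat.gcd m y)) a) := by
    have h := hab.map (ZMod.castHom hdm (ZMod (Nat.gcd m y)))
    rwa [← hy, map_natCast, (ZMod.natCast_eq_zero_iff _ _).mpr hdy, isCoprime_zero_right] at h
  obtain ⟨w, hw⟩ := ZMod.unitsMap_surjective hdy hu.unit
  have hw' : ZMod.castHom hdy (ZMod (Nat.gcd m y)) (w : ZMod y) =
      ZMod.castHom hdm (ZMod (Nat.gcd m y)) a := congrArg Units.val hw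
  have hcop : Nat.Coprime (w : ZMod y).val y := ZMod.val_coe_unit_coprime w
  have hmod : (Nat.gcd m y : ℤ) ∣ ((w : ZMod y).val : ℤ) - (a.val : ℤ) := by
    rw [← ZMod.intCast_zmod_eq_zero_iff_dvd]
    rw [← ZMod.natCast_zmod_val (w : ZMod y), ← ZMod.natCast_zmod_val a, map_natCast,
      map_natCast] at hw'
    push_cast
    rw [hw', sub_self]
  obtain ⟨q, hq⟩ := hmod
  rw [Nat.gcd_eq_gcd_ab] at hq
  refine ⟨((w : ZMod y).val : ℤ) - y * (Nat.gcdB m y * q), y, ?_, ?_, ?_⟩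
  · have h := (Nat.isCoprime_iff_coprime.mpr hcop).add_mul_left_left (-(Nat.gcdB m y * q))
    rwa [mul_neg, ← sub_eq_add_neg] at h
  · have : ((w : ZMod y).val : ℤ) - y * (Nat.gcdB m y * q) =
        a.val + m * (Nat.gcdA m y * q) := by linear_combination hq
    rw [this]
    push_cast
    simp
  · simpa using hy

/-! ### The index of `Γ(m,n)` in `SL₂(ℤ)` -/

namespace CongruenceSubgroup

lemma intCast_det (m : ℕ) (A : SL(2, ℤ)) :
    (A 0 0 : ZMod m) * A 1 1 - A 0 1 * A 1 0 = 1 := by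
  have h := A.det_coe
  rw [Matrix.det_fin_two] at h
  exact_mod_cast congrArg (Int.cast (R := ZMod m)) h

lemma mem_GammaPair_iff {m n : ℕ} {A : SL(2, ℤ)} : A ∈ GammaPair m n ↔
    ((A 0 0 : ZMod m) = 1 ∧ (A 0 1 : ZMod m) = 0) ∧
      (A 1 0 : ZMod n) = 0 ∧ (A 1 1 : ZMod n) = 1 := by
  have h : ∀ (k : ℕ) (a b : ℤ), a ≡ b [ZMOD k] ↔ (a : ZMod k) = b :=
    fun k a b => (ZMod.intCast_eq_intCast_iff a b k).symm
  change (_ ∧ _ ∧ _ ∧ _) ↔ _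
  simp only [h, Int.cast_one, Int.cast_zero, and_assoc]

/-- The determinant upgrades the condition on the last entry from modulo `n` to modulo `m`. -/
lemma intCast_apply_one_one {m n : ℕ} {A : SL(2, ℤ)} (hA : A ∈ GammaPair m n) :
    (A 1 1 : ZMod m) = 1 := by
  obtain ⟨⟨ha, hb⟩, -⟩ := mem_GammaPair_iff.mp hA
  have h := intCast_det m A
  simpa [ha, hb] using h

lemma mem_GammaPair_one_iff {m : ℕ} {A : SL(2, ℤ)} : A ∈ GammaPair m 1 ↔
    (A 0 0 : ZMod m) = 1 ∧ (A 0 1 : ZMod m) = 0 := by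
  rw [mem_GammaPair_iff, and_iff_left]
  exact ⟨Subsingleton.elim _ _, Subsingleton.elim _ _⟩

/-- The top row of the inverse of a matrix, modulo `m`. -/
def invTopRow (m : ℕ) (A : SL(2, ℤ)) : UnimodularPairs (ZMod m) :=
  ⟨((A 1 1 : ZMod m), (-A 0 1 : ZMod m)), by
    have h := intCast_det m A
    exact ⟨(A 0 0 : ZMod m), (A 1 0 : ZMod m), by linear_combination h⟩⟩

lemma inv_mul_apply_zero (A B : SL(2, ℤ)) :
    (A⁻¹ * B) 0 0 = A 1 1 * B 0 0 - A 0 1 * B 1 0 ∧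
      (A⁻¹ * B) 0 1 = A 1 1 * B 0 1 - A 0 1 * B 1 1 := by
  simp [Matrix.mul_apply, Matrix.adjugate_fin_two, sub_eq_add_neg]

/-- Right multiplication of `A` by `Γ(m,1)` multiplies `A⁻¹` on the left by matrices of top row `(1,
0)` modulo `m`, so `invTopRow` separates left cosets. -/
lemma invTopRow_eq_iff (m : ℕ) (A B : SL(2, ℤ)) :
    invTopRow m A = invTopRow m B ↔ A⁻¹ * B ∈ GammaPair m 1 := by
  have hA := intCast_det m A
  have hB := intCast_det m B
  obtain ⟨h00, h01⟩ := inv_mul_apply_zero A B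
  rw [mem_GammaPair_one_iff, h00, h01, Subtype.ext_iff, Prod.ext_iff]
  change (A 1 1 : ZMod m) = B 1 1 ∧ (-A 0 1 : ZMod m) = -B 0 1 ↔ _
  rw [neg_inj]
  push_cast
  constructor
  · rintro ⟨h1, h2⟩
    rw [h1, h2]
    exact ⟨by linear_combination hB, by ring⟩
  · rintro ⟨h1, h2⟩
    exact ⟨by
      linear_combination (B 1 1 : ZMod m) * h1 - (B 1 0 : ZMod m) * h2 - (A 1 1 : ZMod m) * hB, by
      linear_combination (B 0 1 : ZMod m) * h1 - (B 0 0 : ZMod m) * h2 - (A 0 1 : ZMod m) * hB⟩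

lemma invTopRow_surjective {m : ℕ} (hm : m ≠ 0) : Function.Surjective (invTopRow m) := by
  rintro ⟨⟨a, b⟩, hab⟩
  obtain ⟨x, y, ⟨u, v, huv⟩, hx, hy⟩ := ZMod.exists_isCoprime_intCast_eq hm a b hab
  refine ⟨⟨!![u, -y; v, x], by rw [Matrix.det_fin_two_of]; linear_combination huv⟩, ?_⟩
  refine Subtype.ext (Prod.ext ?_ ?_)
  · simpa [invTopRow] using hx
  · simpa [invTopRow] using hy

lemma index_GammaPair_one {m : ℕ} (hm : m ≠ 0) :
    (GammaPair m 1).index = Nat.card (UnimodularPairs (ZMod m)) := by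
  refine Nat.card_congr (Equiv.ofBijective
    (Quotient.lift (invTopRow m) fun A B h => ?_) ⟨?_, ?_⟩)
  · exact (invTopRow_eq_iff m A B).mpr (QuotientGroup.leftRel_apply.mp h)
  · rintro ⟨A⟩ ⟨B⟩ h
    exact Quotient.sound (QuotientGroup.leftRel_apply.mpr ((invTopRow_eq_iff m A B).mp h))
  · intro v
    obtain ⟨A, hA⟩ := invTopRow_surjective hm v
    exact ⟨QuotientGroup.mk A, hA⟩

lemma GammaPair_le_GammaPair_one (m n : ℕ) : GammaPair m n ≤ GammaPair m 1 := fun _ hA =>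
  mem_GammaPair_one_iff.mpr (mem_GammaPair_iff.mp hA).1

/-- Reduction modulo `n` of the lower left entry. -/
def lowerLeftHom {m n : ℕ} (hnm : n ∣ m) : GammaPair m 1 →* Multiplicative (ZMod n) where
  toFun A := Multiplicative.ofAdd ((A : SL(2, ℤ)) 1 0 : ZMod n)
  map_one' := by simp
  map_mul' A B := by
    have hB := congrArg (ZMod.castHom hnm (ZMod n)) (mem_GammaPair_one_iff.mp B.2).1
    have hA := congrArg (ZMod.castHom hnm (ZMod n)) (intCast_apply_one_one A.2)
    rw [map_intCast, map_one] at hA hB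
    rw [← ofAdd_add]
    congr 1
    simp only [Subgroup.coe_mul, Matrix.SpecialLinearGroup.coe_mul, Matrix.mul_apply,
      Fin.sum_univ_two]
    push_cast
    rw [hA, hB]
    ring

lemma ker_lowerLeftHom {m n : ℕ} (hnm : n ∣ m) :
    (lowerLeftHom hnm).ker = (GammaPair m n).subgroupOf (GammaPair m 1) := by
  ext A
  rw [MonoidHom.mem_ker, Subgroup.mem_subgroupOf, mem_GammaPair_iff]
  have hA := congrArg (ZMod.castHom hnm (ZMod n)) (intCast_apply_one_one A.2)
  rw [map_intCast, map_one] at hA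
  simp only [mem_GammaPair_one_iff.mp A.2, hA, true_and, and_true]
  rfl

lemma lowerLeftHom_surjective {m n : ℕ} (hnm : n ∣ m) :
    Function.Surjective (lowerLeftHom hnm) := by
  intro c
  obtain ⟨k, hk⟩ := ZMod.intCast_surjective (Multiplicative.toAdd c)
  refine ⟨⟨⟨!![1, 0; k, 1], by simp [Matrix.det_fin_two_of]⟩,
    mem_GammaPair_one_iff.mpr (by simp)⟩, ?_⟩
  change Multiplicative.ofAdd ((k : ℤ) : ZMod n) = c
  rw [hk]; rfl

/-- `Γ(m,n)` is the kernel of the surjection `lowerLeftHom` from `Γ(m,1)` onto `ZMod n`. -/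
theorem index_GammaPair {m n : ℕ} (hm : m ≠ 0) (hnm : n ∣ m) :
    (GammaPair m n).index = n * Nat.card (UnimodularPairs (ZMod m)) := by
  rw [← Subgroup.relIndex_mul_index (GammaPair_le_GammaPair_one m n), index_GammaPair_one hm,
    Subgroup.relIndex, ← ker_lowerLeftHom hnm, Subgroup.index_ker,
    MonoidHom.range_eq_top.mpr (lowerLeftHom_surjective hnm), Subgroup.card_top]
  congr 1
  exact Nat.card_zmod n

end CongruenceSubgroup

/-! ### Freeness of the action groupoid -/

section ActionGroupoid

open CategoryTheory CategoryTheory.ActionCategory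

variable {G X : Type} [Group G] [MulAction G X] {K : Type} [Group K]

/-- Functors on the action groupoid are determined by their homomorphisms to the semidirect
product. -/
lemma functor_eq_of_curry_eq {E F : ActionCategory G X ⥤ SingleObj K} (h : curry E = curry F) :
    E = F := by
  apply CategoryTheory.Functor.hext
  · intro
    apply Unit.ext
  · refine ActionCategory.cases fun t g => ?_
    have h1 := congrArg (fun φ : G →* (X → K) ⋊[mulAutArrow] G => (φ g).left t) h
    exact heq_of_eq h1

/-- `curry` sends a functor to a homomorphism `G → (X → K) ⋊ G` over `G`. The relations of `s` and
`u` in the semidirect product become pointwise conditions on labellings. -/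
lemma mk_sq_eq_one_iff {s : G} (hs : s ^ 2 = 1) (c : X → K) :
    (⟨c, s⟩ : (X → K) ⋊[mulAutArrow] G) ^ 2 = 1 ↔ ∀ b, c b * c (s⁻¹ • b) = 1 := by
  rw [pow_two] at hs ⊢
  rw [SemidirectProduct.ext_iff]
  constructor
  · exact fun h b => congrFun h.1 b
  · exact fun h => ⟨funext h, hs⟩

lemma mk_cube_eq_one_iff {u : G} (hu : u ^ 3 = 1) (c : X → K) :
    (⟨c, u⟩ : (X → K) ⋊[mulAutArrow] G) ^ 3 = 1 ↔
      ∀ b, c b * (c (u⁻¹ • b) * c (u⁻¹ • u⁻¹ • b)) = 1 := by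
  rw [pow_succ', pow_two] at hu ⊢
  rw [SemidirectProduct.ext_iff]
  constructor
  · exact fun h b => congrFun h.1 b
  · exact fun h => ⟨funext h, hu⟩

lemma IsModularPresentation.functor_ext {s u : G} (h : IsModularPresentation s u)
    {E F : ActionCategory G X ⥤ SingleObj K}
    (hs : ∀ b, E.map (homOfPair b s) = F.map (homOfPair b s))
    (hu : ∀ b, E.map (homOfPair b u) = F.map (homOfPair b u)) : E = F :=
  functor_eq_of_curry_eq (h.hom_ext _ _ (SemidirectProduct.ext (funext hs) rfl)
    (SemidirectProduct.ext (funext hu) rfl))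

lemma IsModularPresentation.functor_relations {s u : G} (h : IsModularPresentation s u)
    (F : ActionCategory G X ⥤ SingleObj K) :
    (∀ b, (F.map (homOfPair b s) : K) * (F.map (homOfPair (s⁻¹ • b) s) : K) = 1) ∧
    ∀ b, (F.map (homOfPair b u) : K) * ((F.map (homOfPair (u⁻¹ • b) u) : K) *
      (F.map (homOfPair (u⁻¹ • u⁻¹ • b) u) : K)) = 1 := by
  constructor
  · exact (mk_sq_eq_one_iff h.sq_eq_one fun b => (F.map (homOfPair b s) : K)).mp
      (by rw [← map_one (curry F), ← h.sq_eq_one, map_pow]; rfl)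
  · exact (mk_cube_eq_one_iff h.cube_eq_one fun b => (F.map (homOfPair b u) : K)).mp
      (by rw [← map_one (curry F), ← h.cube_eq_one, map_pow]; rfl)

lemma IsModularPresentation.exists_functor {s u : G} (h : IsModularPresentation s u)
    (c d : X → K) (hc : ∀ b, c b * c (s⁻¹ • b) = 1)
    (hd : ∀ b, d b * (d (u⁻¹ • b) * d (u⁻¹ • u⁻¹ • b)) = 1) :
    ∃ F : ActionCategory G X ⥤ SingleObj K,
      (∀ b, F.map (homOfPair b s) = c b) ∧ ∀ b, F.map (homOfPair b u) = d b := by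
  obtain ⟨F', hs, hu⟩ := h.exists_lift
    (⟨c, s⟩ : (X → K) ⋊[mulAutArrow] G) ⟨d, u⟩
    ((mk_sq_eq_one_iff h.sq_eq_one c).mpr hc) ((mk_cube_eq_one_iff h.cube_eq_one d).mpr hd)
  -- Only sections of the projection to `G` come from functors.
  have key : SemidirectProduct.rightHom.comp F' = MonoidHom.id G :=
    h.hom_ext _ _ (by simp [hs]) (by simp [hu])
  refine ⟨uncurry F' (DFunLike.ext_iff.mp key), fun b => ?_, fun b => ?_⟩
  · exact congrFun (congrArg SemidirectProduct.left hs) b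
  · exact congrFun (congrArg SemidirectProduct.left hu) b

/-- A set meeting every orbit of an involution exactly once. -/
def IsHalf (s : G) (A : Set X) : Prop := ∀ x, s • x ∈ A ↔ x ∉ A

/-- A set meeting every orbit of an element of order three exactly once. -/
structure IsThird (u : G) (B : Set X) : Prop where
  smul_notMem : ∀ x ∈ B, u • x ∉ B
  exists_mem : ∀ x, x ∈ B ∨ u • x ∈ B ∨ u • u • x ∈ B

/-- The generating arrows of the action groupoid: one for each orbit of `s` and two for each
orbit of `u`. -/
abbrev modularQuiver (s u : G) (A B : Set X) :
    Quiver.{0} (IsFreeGroupoid.Generators (ActionCategory G X)) :=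
  ⟨fun a b => { e : Bool // cond e
    (u • ActionCategory.back a = ActionCategory.back b ∧ ActionCategory.back b ∉ B)
    (s • ActionCategory.back a = ActionCategory.back b ∧ ActionCategory.back b ∈ A) }⟩

variable {s u : G} {A B : Set X}

/-- The arrow of the action groupoid underlying a generating arrow. -/
def modularQuiverHom (a b : ActionCategory G X)
    (e : (modularQuiver s u A B).Hom a b) : a ⟶ b :=
  match e with
  | ⟨true, h⟩ => ⟨u, h.1⟩
  | ⟨false, h⟩ => ⟨s, h.1⟩

open scoped Classical in
/-- The action groupoid is free on the generating arrows `modularQuiver`. -/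
noncomputable abbrev IsModularPresentation.isFreeGroupoid (h : IsModularPresentation s u)
    (hA : IsHalf s A) (hB : IsThird u B) : IsFreeGroupoid (ActionCategory G X) where
  quiverGenerators := modularQuiver s u A B
  of := fun {a b} e => modularQuiverHom a b e
  unique_lift := by
    intro K _ f
    let cS : X → K := fun b => if hb : b ∈ A then
      @f ((s⁻¹ • b : X) : ActionCategory G X) (b : ActionCategory G X)
        ⟨false, smul_inv_smul s b, hb⟩ else 1
    let cU : X → K := fun b => if hb : b ∈ B then 1 else
      @f ((u⁻¹ • b : X) : ActionCategory G X) (b : ActionCategory G X)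
        ⟨true, smul_inv_smul u b, hb⟩
    have huuu : ∀ x : X, u • u • u • x = x := fun x => by
      rw [smul_smul, smul_smul, ← pow_two, ← pow_succ, h.cube_eq_one, one_smul]
    have hss : ∀ x : X, s • s • x = x := fun x => by
      rw [smul_smul, ← pow_two, h.sq_eq_one, one_smul]
    have hs' : ∀ x : X, s⁻¹ • x = s • x := fun x => by rw [inv_smul_eq_iff, hss]
    have hu' : ∀ x : X, u⁻¹ • x = u • u • x := fun x => by rw [inv_smul_eq_iff, huuu]
    -- Each relation determines the label missing from its orbit: off `A` from the partner under
    -- `s`, on `B` from the two other points of the `u`-orbit.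
    obtain ⟨F, hFs, hFu⟩ := h.exists_functor
      (fun b => if b ∈ A then cS b else (cS (s • b))⁻¹)
      (fun b => if b ∈ B then (cU (u • u • b) * cU (u • b))⁻¹ else cU b)
      (by
        intro b
        rw [hs', hss]
        by_cases hb : b ∈ A
        · have : s • b ∉ A := fun h' => (hA b).mp h' hb
          simp [hb, this]
        · have : s • b ∈ A := (hA b).mpr hb
          simp [hb, this])
      (by
        intro b
        simp only [hu', huuu]
        have h3 : ∀ x, x ∈ B → u • x ∉ B ∧ u • u • x ∉ B := fun x hx =>
          ⟨hB.smul_notMem x hx, fun h' => hB.smul_notMem _ h' (by rwa [huuu])⟩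
        rcases hB.exists_mem b with hb | hb | hb
        · have := h3 b hb
          simp only [hb, this.1, this.2, if_true, if_false]
          simp
        · have := h3 _ hb
          rw [huuu] at this
          simp only [hb, this.1, this.2, if_true, if_false]
          group
        · have := h3 _ hb
          rw [huuu] at this
          simp only [hb, this.1, this.2, if_true, if_false]
          group)
    refine ⟨F, ?_, ?_⟩
    · rintro ⟨⟨⟩, a : X⟩ ⟨⟨⟩, b : X⟩ ⟨_ | _, (h1 : _ • a = b), h2⟩
      · obtain rfl : a = s⁻¹ • b := by rw [← h1, inv_smul_smul]
        refine (hFs b).trans ?_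
        have h2' : b ∈ A := h2
        simp only [h2', if_true, cS, dif_pos]
      · obtain rfl : a = u⁻¹ • b := by rw [← h1, inv_smul_smul]
        refine (hFu b).trans ?_
        have h2' : b ∉ B := h2
        simp only [h2', if_false, cU, dif_neg, not_false_eq_true]
    · intro E hE
      have hES : ∀ b ∈ A, E.map (homOfPair b s) = cS b := fun b hb => by
        simp only [cS, dif_pos hb]
        exact hE ((s⁻¹ • b : X) : ActionCategory G X) (b : ActionCategory G X)
          ⟨false, smul_inv_smul s b, hb⟩
      have hEU : ∀ b ∉ B, E.map (homOfPair b u) = cU b := fun b hb => by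
        simp only [cU, dif_neg hb]
        exact hE ((u⁻¹ • b : X) : ActionCategory G X) (b : ActionCategory G X)
          ⟨true, smul_inv_smul u b, hb⟩
      -- `E` satisfies the same relations, so its labels off `A` and on `B` are forced too.
      obtain ⟨r1, r2⟩ := h.functor_relations E
      let φ : X → K := fun b => E.map (homOfPair b u)
      have r2' : ∀ b, φ b * (φ (u⁻¹ • b) * φ (u⁻¹ • u⁻¹ • b)) = 1 := r2
      refine h.functor_ext (fun b => ?_) fun b => ?_
      · rw [hFs]
        by_cases hb : b ∈ A
        · rw [if_pos hb, hES b hb]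
        · rw [if_neg hb, ← hES _ ((hA b).mpr hb), ← hs']
          exact eq_inv_of_mul_eq_one_left (r1 b)
      · rw [hFu]
        by_cases hb : b ∈ B
        · rw [if_pos hb, ← hEU _ (hB.smul_notMem b hb), ← hEU (u • u • b)
            (fun h' => hB.smul_notMem _ h' (by rwa [huuu]))]
          have := r2' b
          rw [hu', hu', huuu] at this
          exact eq_inv_of_mul_eq_one_left this
        · rw [if_neg hb, hEU b hb]

end ActionGroupoid

/-! ### The rank of a vertex group, by counting functors -/

section FunctorCount

open CategoryTheory

/-- Conjugation by chosen arrows from `r` turns an endomorphism-valued map and vertex labels into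
a functor to a group. -/
noncomputable def functorOfVertexLabels {C : Type} [Groupoid.{0} C] (r : C) {K : Type} [Group K]
    (p : ∀ x, r ⟶ x) (f : End r →* K) (c : C → K) : C ⥤ SingleObj K where
  obj _ := ()
  map {x y} q := (c y * f (p x ≫ q ≫ inv (p y) : r ⟶ r) * (c x)⁻¹ : K)
  map_id x := by
    rw [Category.id_comp, IsIso.hom_inv_id, ← End.one_def, f.map_one, mul_one, mul_inv_cancel]
    rfl
  map_comp {x y z} q q' := by
    have key : f (p x ≫ (q ≫ q') ≫ inv (p z) : r ⟶ r) =
        f (p y ≫ q' ≫ inv (p z) : r ⟶ r) * f (p x ≫ q ≫ inv (p y) : r ⟶ r) := by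
      refine (congrArg f ?_).trans (f.map_mul _ _)
      change _ = (p x ≫ q ≫ inv (p y)) ≫ (p y ≫ q' ≫ inv (p z))
      simp
    rw [key, SingleObj.comp_as_mul]
    group

open scoped Classical in
/-- Functors from a connected groupoid to a group are given by homomorphisms on a vertex group and
arbitrary labels at the other vertices. -/
noncomputable def functorEquivOfConnected {C : Type} [Groupoid.{0} C] (r : C)
    (hC : ∀ x : C, Nonempty (r ⟶ x)) (K : Type) [Group K] :
    (C ⥤ SingleObj K) ≃ (End r →* K) × ({x : C // x ≠ r} → K) :=
  -- Choosing the identity at `r` normalises the label there to `1`, leaving labels only at the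
  -- other vertices.
  let p : ∀ x, r ⟶ x := fun x => if h : r = x then eqToHom h else (hC x).some
  have hp : p r = 𝟙 r := by simp [p]
  { toFun := fun F => (F.mapEnd r, fun x => F.map (p x))
    invFun := fun fc => functorOfVertexLabels r p fc.1
      fun x => if h : x = r then 1 else fc.2 ⟨x, h⟩
    left_inv := by
      intro F
      apply CategoryTheory.Functor.hext
      · intro
        apply Unit.ext
      intro x y q
      apply heq_of_eq
      have hc : ∀ x, (if h : x = r then (1 : K) else F.map (p x)) = F.map (p x) := by
        intro x
        split_ifs with h
        · subst h
          rw [hp, F.map_id]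
          rfl
        · rfl
      change ((if h : y = r then (1 : K) else F.map (p y)) *
        F.map (p x ≫ q ≫ inv (p y) : r ⟶ r) *
          (if h : x = r then (1 : K) else F.map (p x))⁻¹ : K) = F.map q
      rw [hc, hc, F.map_comp, F.map_comp, F.map_inv, SingleObj.comp_as_mul,
        SingleObj.comp_as_mul, SingleObj.inv_as_inv]
      group
    right_inv := by
      rintro ⟨f, c⟩
      refine Prod.ext ?_ ?_
      · ext e
        change ((if h : r = r then (1 : K) else c ⟨r, h⟩) * f (p r ≫ e ≫ inv (p r) : r ⟶ r) *
          (if h : r = r then (1 : K) else c ⟨r, h⟩)⁻¹ : K) = f e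
        rw [dif_pos rfl, hp]
        simp
      · ext x
        change ((if h : x.1 = r then (1 : K) else c ⟨x.1, h⟩) *
          f (p r ≫ p x ≫ inv (p x) : r ⟶ r) *
          (if h : r = r then (1 : K) else c ⟨r, h⟩)⁻¹ : K) = c x
        rw [dif_pos rfl, dif_neg x.2, IsIso.hom_inv_id, hp, Category.comp_id, ← End.one_def,
          f.map_one]
        simp }

/-- Functors from a free groupoid to a group are given by labels on the generating arrows. -/
noncomputable def functorEquivLabelling {C : Type} [Groupoid.{0} C] [IsFreeGroupoid C] (K : Type)
    [Group K] :
    (C ⥤ SingleObj K) ≃ ((Σ a b : IsFreeGroupoid.Generators C, (a ⟶ b)) → K) :=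
  Equiv.ofBijective (fun F e => F.map (IsFreeGroupoid.of e.2.2)) ⟨fun E F h =>
    IsFreeGroupoid.ext_functor E F fun a b e => congrFun h ⟨a, b, e⟩, fun f => by
      obtain ⟨F, hF, -⟩ := IsFreeGroupoid.unique_lift (G := C)
        (fun a b e => f ⟨a, b, e⟩ : Quiver.Labelling (IsFreeGroupoid.Generators C) K)
      exact ⟨F, funext fun e => hF _ _ _⟩⟩

/-- Every basis of a vertex group of a finite connected free groupoid has one minus the Euler
characteristic of the generating graph many elements. -/
theorem IsFreeGroupoid.card_basis_end {C : Type} [Groupoid.{0} C] [IsFreeGroupoid C] [Finite C]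
    (r : C) (hC : ∀ x : C, Nonempty (r ⟶ x))
    [Finite (Σ a b : IsFreeGroupoid.Generators C, (a ⟶ b))] {ι : Type}
    (b : FreeGroupBasis ι (End r)) :
    Finite ι ∧ Nat.card ι + Nat.card C =
      Nat.card (Σ a b : IsFreeGroupoid.Generators C, (a ⟶ b)) + 1 := by
  -- Counting functors to a group of order 2 in two ways equates powers of 2, hence exponents.
  let K := Multiplicative (ZMod 2)
  have e : (ι → K) × ({x : C // x ≠ r} → K) ≃
      ((Σ a b : IsFreeGroupoid.Generators C, (a ⟶ b)) → K) :=
    (Equiv.prodCongr b.lift (Equiv.refl _)).trans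
      ((functorEquivOfConnected r hC K).symm.trans (functorEquivLabelling K))
  have hfin : Finite ((ι → K) × ({x : C // x ≠ r} → K)) := Finite.of_equiv _ e.symm
  have hfin' : Finite (ι → K) := Finite.prod_left ({x : C // x ≠ r} → K)
  classical
  have hι : Finite ι := by
    refine Finite.of_injective
      (fun i j => if i = j then Multiplicative.ofAdd 1 else 1 : ι → ι → K) fun i j h => ?_
    by_contra hij
    have h' := congrFun h i
    simp only [if_true, if_neg (Ne.symm hij)] at h'
    exact absurd h' (by decide)
  refine ⟨hι, ?_⟩
  have hcard := Nat.card_congr e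
  have hK : Nat.card K = 2 := Nat.card_zmod 2
  rw [Nat.card_prod, Nat.card_fun, Nat.card_fun, Nat.card_fun, hK, ← pow_add] at hcard
  have h1 := Nat.pow_right_injective le_rfl hcard
  have h2 : Nat.card {x : C // x ≠ r} + 1 = Nat.card C := by
    have := Fintype.ofFinite C
    rw [Nat.card_eq_fintype_card, Nat.card_eq_fintype_card, Fintype.card_subtype_compl,
      Fintype.card_subtype_eq]
    have : 0 < Fintype.card C := Fintype.card_pos_iff.mpr ⟨r⟩
    omega
  omega

/-- The vertex groups of a finite connected free groupoid are free of rank one minus the Euler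
characteristic of the generating graph. -/
theorem IsFreeGroupoid.exists_basis_end {C : Type} [Groupoid.{0} C] [IsFreeGroupoid C] [Finite C]
    (r : C) (hC : ∀ x y : C, Nonempty (x ⟶ y))
    [Finite (Σ a b : IsFreeGroupoid.Generators C, (a ⟶ b))] :
    ∃ n : ℕ, n + Nat.card C = Nat.card (Σ a b : IsFreeGroupoid.Generators C, (a ⟶ b)) + 1 ∧
      Nonempty (FreeGroupBasis (Fin n) (End r)) := by
  have : Nonempty C := ⟨r⟩
  have : IsConnected C := zigzag_isConnected fun x y =>
    Relation.ReflTransGen.single (Or.inl (hC x y))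
  -- Nielsen–Schreier gives freeness; the functor count then gives the rank.
  obtain ⟨ι, ⟨b⟩⟩ := (IsFreeGroupoid.endIsFreeOfConnectedFree r).nonempty_basis
  obtain ⟨hι, hcard⟩ := IsFreeGroupoid.card_basis_end r (hC r) b
  exact ⟨Nat.card ι, hcard, ⟨b.reindex (Finite.equivFin ι)⟩⟩

end FunctorCount

/-! ### Transversals, and the rank in terms of the index -/

section Counting

variable {G X : Type} [Group G] [MulAction G X] {s u : G} {A B : Set X}

/-- Number the points and keep the least of each orbit; likewise in `exists_isThird`. -/
lemma exists_isHalf [Finite X] (hs : s ^ 2 = 1) (h : ∀ x : X, s • x ≠ x) :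
    ∃ A : Set X, IsHalf s A := by
  obtain ⟨n, ⟨e⟩⟩ := Finite.exists_equiv_fin X
  refine ⟨{x | e x < e (s • x)}, fun x => ?_⟩
  have h1 : s • s • x = x := by rw [smul_smul, ← pow_two, hs, one_smul]
  have h2 : e (s • x) ≠ e x := fun h' => h x (e.injective h')
  simp only [Set.mem_ofPred_eq, h1, not_lt]
  exact ⟨le_of_lt, fun h' => lt_of_le_of_ne h' h2⟩

lemma exists_isThird [Finite X] (hu : u ^ 3 = 1) (h : ∀ x : X, u • x ≠ x) :
    ∃ B : Set X, IsThird u B := by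
  obtain ⟨n, ⟨e⟩⟩ := Finite.exists_equiv_fin X
  have huuu : ∀ x : X, u • u • u • x = x := fun x => by
    rw [smul_smul, smul_smul, ← pow_two, ← pow_succ, hu, one_smul]
  have hne : ∀ x : X, e (u • x) ≠ e x := fun x h' => h x (e.injective h')
  refine ⟨{x | e x < e (u • x) ∧ e x < e (u • u • x)}, ⟨fun x hx hx' => ?_, fun x => ?_⟩⟩
  · simp only [Set.mem_ofPred_eq, huuu] at hx hx'
    exact lt_asymm hx.1 hx'.2
  · have h1 := hne x
    have h2 := hne (u • x)
    have h3 := hne (u • u • x)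
    simp only [Set.mem_ofPred_eq, huuu] at h1 h2 h3 ⊢
    rw [ne_eq, Fin.ext_iff] at h1 h2 h3
    simp only [Fin.lt_def]
    omega

/-- The indicators of `A` at `x` and `s • x` add up to 1; sum over `x`. -/
lemma IsHalf.two_mul_card [Finite X] (hA : IsHalf s A) :
    2 * Nat.card A = Nat.card X := by
  classical
  have := Fintype.ofFinite X
  have h1 : ∑ x : X, (if s • x ∈ A then 1 else 0) = ∑ x : X, if x ∈ A then 1 else 0 :=
    Equiv.sum_comp (MulAction.toPerm s) fun x => if x ∈ A then 1 else 0
  have h2 : ∀ x, (if x ∈ A then 1 else 0) + (if s • x ∈ A then 1 else 0) = 1 := fun x => by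
    by_cases hx : x ∈ A
    · simp [hx, mt (hA x).mp (not_not.mpr hx)]
    · simp [hx, (hA x).mpr hx]
  rw [Nat.card_eq_fintype_card, Nat.card_eq_fintype_card, Fintype.card_subtype,
    ← Finset.card_univ, Finset.card_eq_sum_ones Finset.univ, ← Finset.sum_congr rfl fun x _ => h2 x,
    Finset.sum_add_distrib, h1, Finset.card_filter, two_mul]

lemma IsThird.three_mul_card [Finite X] (hu : u ^ 3 = 1) (hB : IsThird u B) :
    3 * Nat.card B = Nat.card X := by
  classical
  have := Fintype.ofFinite X
  have huuu : ∀ x : X, u • u • u • x = x := fun x => by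
    rw [smul_smul, smul_smul, ← pow_two, ← pow_succ, hu, one_smul]
  have h1 : ∑ x : X, (if u • x ∈ B then 1 else 0) = ∑ x : X, if x ∈ B then 1 else 0 :=
    Equiv.sum_comp (MulAction.toPerm u) fun x => if x ∈ B then 1 else 0
  have h2 : ∑ x : X, (if u • u • x ∈ B then 1 else 0) = ∑ x : X, if u • x ∈ B then 1 else 0 :=
    Equiv.sum_comp (MulAction.toPerm u) fun x => if u • x ∈ B then 1 else 0
  have h3 : ∀ x, (if x ∈ B then 1 else 0) + (if u • x ∈ B then 1 else 0) +
      (if u • u • x ∈ B then 1 else 0) = 1 := fun x => by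
    have e1 := hB.smul_notMem x
    have e2 := hB.smul_notMem (u • x)
    have e3 := hB.smul_notMem (u • u • x)
    have e4 := hB.exists_mem x
    rw [huuu] at e3
    split_ifs <;> tauto
  rw [Nat.card_eq_fintype_card, Nat.card_eq_fintype_card, Fintype.card_subtype,
    ← Finset.card_univ, Finset.card_eq_sum_ones Finset.univ, ← Finset.sum_congr rfl fun x _ => h3 x,
    Finset.sum_add_distrib, Finset.sum_add_distrib, h2, h1, Finset.card_filter]
  ring

open CategoryTheory

/-- The generating arrows are indexed by their type and target. -/
def modularQuiverTotalEquiv (s u : G) (A B : Set X) :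
    (Σ a b : IsFreeGroupoid.Generators (ActionCategory G X), (modularQuiver s u A B).Hom a b) ≃
      A ⊕ (Bᶜ : Set X) where
  toFun
    | ⟨_, _, ⟨true, h⟩⟩ => Sum.inr ⟨_, h.2⟩
    | ⟨_, _, ⟨false, h⟩⟩ => Sum.inl ⟨_, h.2⟩
  invFun
    | Sum.inl b => ⟨((s⁻¹ • b.1 : X) : ActionCategory G X), ((b.1 : X) : ActionCategory G X),
        ⟨false, smul_inv_smul s b.1, b.2⟩⟩
    | Sum.inr b => ⟨((u⁻¹ • b.1 : X) : ActionCategory G X), ((b.1 : X) : ActionCategory G X),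
        ⟨true, smul_inv_smul u b.1, b.2⟩⟩
  left_inv := by
    rintro ⟨⟨⟨⟩, a : X⟩, ⟨⟨⟩, b : X⟩, ⟨_ | _, (h1 : _ • a = b), h2⟩⟩
    · obtain rfl : a = s⁻¹ • b := by rw [← h1, inv_smul_smul]
      rfl
    · obtain rfl : a = u⁻¹ • b := by rw [← h1, inv_smul_smul]
      rfl
  right_inv := by rintro (b | b) <;> rfl

/-- A finite index subgroup of the modular group without conjugates of the two generating torsion
elements is free, of rank determined by its index. -/
theorem IsModularPresentation.exists_freeGroupBasis (h : IsModularPresentation s u)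
    (H : Subgroup G) [H.FiniteIndex] (hs : ∀ g : G, g⁻¹ * s * g ∉ H)
    (hu : ∀ g : G, g⁻¹ * u * g ∉ H) :
    ∃ r : ℕ, 6 * r = H.index + 6 ∧ Nonempty (FreeGroupBasis (Fin r) H) := by
  -- A coset `gH` is fixed by `t` exactly when `g⁻¹ * t * g ∈ H`.
  have hfree : ∀ t : G, (∀ g : G, g⁻¹ * t * g ∉ H) → ∀ x : G ⧸ H, t • x ≠ x := by
    rintro t ht ⟨g⟩ hx
    refine ht g ?_
    have := QuotientGroup.eq.mp (Eq.symm hx : (QuotientGroup.mk g : G ⧸ H) =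
      QuotientGroup.mk (t * g))
    rwa [← mul_assoc] at this
  obtain ⟨A, hA⟩ := exists_isHalf (X := G ⧸ H) h.sq_eq_one (hfree s hs)
  obtain ⟨B, hB⟩ := exists_isThird (X := G ⧸ H) h.cube_eq_one (hfree u hu)
  let inst : IsFreeGroupoid (ActionCategory G (G ⧸ H)) := h.isFreeGroupoid hA hB
  let r := ActionCategory.objEquiv G (G ⧸ H) ((1 : G) : G ⧸ H)
  have : Finite (ActionCategory G (G ⧸ H)) :=
    Finite.of_equiv _ (ActionCategory.objEquiv G (G ⧸ H))
  let e := modularQuiverTotalEquiv s u A B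
  have : Finite (Σ a b : IsFreeGroupoid.Generators (ActionCategory G (G ⧸ H)), (a ⟶ b)) :=
    Finite.of_equiv _ e.symm
  obtain ⟨n, hcard, ⟨b⟩⟩ := IsFreeGroupoid.exists_basis_end r fun x y => by
    obtain ⟨g, hg⟩ := MulAction.exists_smul_eq G x.back y.back
    exact ⟨(⟨g, hg⟩ : x ⟶ y)⟩
  refine ⟨n, ?_, ⟨b.map (ActionCategory.endMulEquivSubgroup H)⟩⟩
  have h1 := hA.two_mul_card
  have h2 := hB.three_mul_card h.cube_eq_one
  have h3 : Nat.card B + Nat.card (Bᶜ : Set (G ⧸ H)) = Nat.card (G ⧸ H) := by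
    classical
    rw [← Nat.card_sum]
    exact Nat.card_congr (Equiv.Set.sumCompl B)
  have h4 : Nat.card (Σ a b : IsFreeGroupoid.Generators (ActionCategory G (G ⧸ H)), (a ⟶ b)) =
      Nat.card A + Nat.card (Bᶜ : Set (G ⧸ H)) := by
    rw [← Nat.card_sum]
    exact Nat.card_congr e
  have h5 : Nat.card (ActionCategory G (G ⧸ H)) = Nat.card (G ⧸ H) :=
    (Nat.card_congr (ActionCategory.objEquiv G (G ⧸ H))).symm
  rw [h4, h5] at hcard
  rw [Subgroup.index]
  -- With `N` the index, `n + N = N/2 + 2N/3 + 1`.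
  omega

end Counting

/-! ### Passage to `PSL₂(ℤ)` and exclusion of torsion by traces -/

namespace CongruenceSubgroup

variable {m n : ℕ}

lemma neg_one_notMem_GammaPair (hm : 3 ≤ m) : (-1 : SL(2, ℤ)) ∉ GammaPair m n := by
  intro h
  have h1 := (mem_GammaPair_iff.mp h).1.1
  have h2 : ((2 : ℕ) : ZMod m) = 0 := by
    simp at h1
    push_cast
    linear_combination -h1
  have := Nat.le_of_dvd two_pos ((ZMod.natCast_eq_zero_iff 2 m).mp h2)
  omega

lemma mk_eq_mk_iff (A B : SL(2, ℤ)) :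
    QuotientGroup.mk' (Subgroup.center SL(2, ℤ)) A = QuotientGroup.mk' _ B ↔
      B = A ∨ B = -A := by
  rw [QuotientGroup.mk'_apply, QuotientGroup.mk'_apply, QuotientGroup.eq,
    ModularGroup.mem_center_iff_eq_one_or_neg_one, inv_mul_eq_iff_eq_mul, inv_mul_eq_iff_eq_mul,
    mul_one, mul_neg, mul_one]

/-- `Γ(m,n)` maps isomorphically to its image in `PSL(2, ℤ)` when it does not contain `-1`. -/
noncomputable def gammaPairEquiv (hm : 3 ≤ m) : GammaPair m n ≃* ProjGammaPair m n :=
  (MonoidHom.ofInjective (f := (QuotientGroup.mk' (Subgroup.center SL(2, ℤ))).comp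
    (GammaPair m n).subtype) (by
      rw [injective_iff_map_eq_one]
      intro A hA
      have h := (mk_eq_mk_iff 1 A.1).mp (by rw [map_one]; exact hA.symm)
      rcases h with h | h
      · exact Subtype.ext h
      · exact absurd (h ▸ A.2) (neg_one_notMem_GammaPair hm))).trans
    (MulEquiv.subgroupCongr (by rw [MonoidHom.range_comp, Subgroup.range_subtype]; rfl))

/-- The preimage of the image of `Γ(m,n)` is the disjoint union of `Γ(m,n)` and `-Γ(m,n)`. -/
lemma index_GammaPair_eq_two_mul (hm : 3 ≤ m) :
    (GammaPair m n).index = 2 * (ProjGammaPair m n).index := by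
  have hsurj := QuotientGroup.mk'_surjective (Subgroup.center SL(2, ℤ))
  rw [← Subgroup.index_comap_of_surjective _ hsurj,
    ← Subgroup.relIndex_mul_index (Subgroup.le_comap_map
      (QuotientGroup.mk' (Subgroup.center SL(2, ℤ))) (GammaPair m n))]
  congr 1
  refine Subgroup.relIndex_eq_two_iff.mpr ⟨-1, ?_, fun b hb => ?_⟩
  · exact ⟨1, one_mem _, (mk_eq_mk_iff _ _).mpr (Or.inr rfl)⟩
  · obtain ⟨A, hA, hAb⟩ := hb
    have hneg : ∀ B ∈ GammaPair m n, -B ∉ GammaPair m n := fun B hB hB' =>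
      neg_one_notMem_GammaPair (n := n) hm
        (by simpa using (GammaPair m n).mul_mem ((GammaPair m n).inv_mem hB) hB')
    rw [mul_neg, mul_one]
    rcases (mk_eq_mk_iff A b).mp hAb with rfl | rfl
    · exact Or.inr ⟨hA, hneg _ hA⟩
    · rw [neg_neg]
      exact Or.inl ⟨hA, hneg _ hA⟩

lemma intCast_trace_of_mem_GammaPair {A : SL(2, ℤ)} (hA : A ∈ GammaPair m n) :
    ((Matrix.trace (A : Matrix (Fin 2) (Fin 2) ℤ) : ℤ) : ZMod m) = 2 := by
  rw [Matrix.trace_fin_two, Int.cast_add, (mem_GammaPair_iff.mp hA).1.1,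
    intCast_apply_one_one hA, one_add_one_eq_two]

/-- Up to sign, the trace is a conjugacy invariant on `PSL(2, ℤ)`. -/
lemma exists_trace_eq_of_conj_mem {X : SL(2, ℤ)} {g : PSL(2, ℤ)}
    (h : g⁻¹ * QuotientGroup.mk' (Subgroup.center SL(2, ℤ)) X * g ∈ ProjGammaPair m n) :
    ∃ A ∈ GammaPair m n, Matrix.trace (A : Matrix (Fin 2) (Fin 2) ℤ) = Matrix.trace X.1 ∨
      Matrix.trace (A : Matrix (Fin 2) (Fin 2) ℤ) = -Matrix.trace X.1 := by
  obtain ⟨C, rfl⟩ := QuotientGroup.mk'_surjective _ g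
  obtain ⟨A, hA, hAX⟩ := h
  refine ⟨A, hA, ?_⟩
  have htr : Matrix.trace (C⁻¹ * X * C).1 = Matrix.trace X.1 := by
    have h1 : (C⁻¹ * X * C).1 = (C⁻¹).1 * (X * C).1 := by rw [mul_assoc]; rfl
    rw [h1, Matrix.trace_mul_comm]
    change Matrix.trace (X * C * C⁻¹).1 = _
    rw [mul_inv_cancel_right]
  rw [← map_inv, ← map_mul, ← map_mul] at hAX
  rcases (mk_eq_mk_iff _ _).mp hAX.symm with h | h
  · left
    rw [h, htr]
  · right
    rw [h, Matrix.SpecialLinearGroup.coe_neg, Matrix.trace_neg, htr]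

lemma natCast_ne_zero_of_lt {k : ℕ} (hk : 0 < k) (hkm : k < m) : (k : ZMod m) ≠ 0 := fun h =>
  absurd (Nat.le_of_dvd hk ((ZMod.natCast_eq_zero_iff k m).mp h)) (by omega)

lemma conj_projS_notMem_ProjGammaPair (hm : 3 ≤ m) (g : PSL(2, ℤ)) :
    g⁻¹ * ModularGroup.projS * g ∉ ProjGammaPair m n := by
  intro h
  obtain ⟨A, hA, htr⟩ := exists_trace_eq_of_conj_mem h
  have hS : Matrix.trace ModularGroup.S.1 = 0 := by
    rw [Matrix.trace_fin_two]; simp [ModularGroup.coe_S]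
  rw [hS, neg_zero, or_self] at htr
  have h2 := intCast_trace_of_mem_GammaPair hA
  rw [htr, Int.cast_zero] at h2
  exact natCast_ne_zero_of_lt (m := m) (k := 2) two_pos (by omega) (by exact_mod_cast h2.symm)

/-- Writing `A = 1 + 3M`, determinant 1 gives `tr A = 2 - 9 det M`, so the trace is 2 modulo 9. -/
lemma trace_ne_neg_one_of_mem_GammaPair_three {A : SL(2, ℤ)} (hA : A ∈ GammaPair 3 3) :
    Matrix.trace (A : Matrix (Fin 2) (Fin 2) ℤ) ≠ -1 := by
  obtain ⟨⟨ha, hb⟩, hc, hd⟩ := mem_GammaPair_iff.mp hA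
  have h0 : ∀ z : ℤ, (z : ZMod 3) = 0 → (3 : ℤ) ∣ z := fun z hz =>
    (ZMod.intCast_zmod_eq_zero_iff_dvd z 3).mp hz
  have h1 : ∀ z : ℤ, (z : ZMod 3) = 1 → (3 : ℤ) ∣ z - 1 := fun z hz =>
    h0 _ (by rw [Int.cast_sub, hz, Int.cast_one, sub_self])
  obtain ⟨a, ha⟩ := h1 _ ha
  obtain ⟨b, hb⟩ := h0 _ hb
  obtain ⟨c, hc⟩ := h0 _ hc
  obtain ⟨d, hd⟩ := h1 _ hd
  have hdet := A.det_coe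
  rw [Matrix.det_fin_two, hb, hc, eq_add_of_sub_eq ha, eq_add_of_sub_eq hd] at hdet
  rw [Matrix.trace_fin_two, eq_add_of_sub_eq ha, eq_add_of_sub_eq hd]
  intro htr
  have : 3 * (a * d - b * c) = 1 := by linarith
  omega

lemma conj_projU_notMem_ProjGammaPair (hm : 3 ≤ m) (hnm : n ∣ m) (hmn : (m, n) ≠ (3, 1))
    (g : PSL(2, ℤ)) : g⁻¹ * ModularGroup.projU * g ∉ ProjGammaPair m n := by
  intro h
  obtain ⟨A, hA, htr⟩ := exists_trace_eq_of_conj_mem h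
  have hU : Matrix.trace ModularGroup.U.1 = 1 := by
    rw [ModularGroup.coe_U, Matrix.trace_fin_two]; simp
  rw [hU] at htr
  have h2 := intCast_trace_of_mem_GammaPair hA
  rcases htr with htr | htr
  · rw [htr, Int.cast_one] at h2
    refine natCast_ne_zero_of_lt (m := m) (k := 1) one_pos (by omega) ?_
    push_cast
    linear_combination -h2
  · rcases hm.lt_or_eq with hm | rfl
    · rw [htr, Int.cast_neg, Int.cast_one] at h2
      refine natCast_ne_zero_of_lt (m := m) (k := 3) three_pos hm ?_
      push_cast
      linear_combination -h2
    · rcases (Nat.dvd_prime Nat.prime_three).mp hnm with rfl | rfl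
      · exact hmn rfl
      · exact trace_ne_neg_one_of_mem_GammaPair_three hA htr

end CongruenceSubgroup

open CongruenceSubgroup in
theorem proposition1p3 (m n : ℕ) (hm : 3 ≤ m) (hnm : n ∣ m) (hmn : (m, n) ≠ (3, 1)) :
    ∃ r : ℕ,
      (r : ℚ) = 1 + (n * m ^ 2 : ℚ) / 12 * ∏ p ∈ m.primeFactors, (1 - 1 / (p : ℚ) ^ 2) ∧
      IsFreeGroupOfRank (CongruenceSubgroup.GammaPair m n) r ∧
      IsFreeGroupOfRank (CongruenceSubgroup.ProjGammaPair m n) r := by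
  have hm0 : m ≠ 0 := by omega
  have hJ := card_unimodularPairs_zmod hm0
  have hidx := index_GammaPair hm0 hnm
  rw [index_GammaPair_eq_two_mul hm] at hidx
  have : NeZero m := ⟨hm0⟩
  have hfin : (ProjGammaPair m n).FiniteIndex := by
    refine ⟨fun h0 => ?_⟩
    -- Index `0` stands for infinite index; it would make `n` or the number of unimodular pairs
    -- vanish.
    rw [h0, mul_zero, eq_comm, mul_eq_zero] at hidx
    rcases hidx with h | h
    · exact hm0 (Nat.eq_zero_of_zero_dvd (h ▸ hnm))
    · have : Nonempty (UnimodularPairs (ZMod m)) := ⟨invTopRow m 1⟩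
      exact Nat.card_pos.ne' h
  obtain ⟨r, hr, ⟨b⟩⟩ := ModularGroup.isModularPresentation.exists_freeGroupBasis
    (ProjGammaPair m n) (conj_projS_notMem_ProjGammaPair hm)
    (conj_projU_notMem_ProjGammaPair hm hnm hmn)
  refine ⟨r, ?_, ⟨b.map (gammaPairEquiv hm).symm⟩, ⟨b⟩⟩
  have hr' : (6 * r : ℚ) = (ProjGammaPair m n).index + 6 := by exact_mod_cast hr
  have hidx' : (2 * (ProjGammaPair m n).index : ℚ) = n * Nat.card (UnimodularPairs (ZMod m)) := by
    exact_mod_cast hidx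
  rw [hJ] at hidx'
  linear_combination hr' / 6 + hidx' / 12
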